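/- Let $L$ be a number field with absolute Galois group $G_L = \mathrm{Gal}(\overline{L}/L)$, let $p$ be a prime number, $K$ a finite extension of $\mathbf{Q}_p$, and $\rho : G_L \to GL_m(K)$ a continuous semisimple representation. For a prime $q$ of $L$ (a nonzero prime ideal of its ring of integers) and a place of $\overline{L}$ above $q$, let $D_q \supseteq I_q \supseteq P_q$ be the decomposition, inertia and wild inertia subgroups of $G_L$ at this place, and let $G_q = D_q/P_q$, which is the Galois group of the maximal tamely ramified extension of the completion $L_q$. Then for all but finitely many primes $q$ of $L$, for every place of $\overline{L}$ above $q$: the restriction $\rho|_{D_q}$ factors through a continuous homomorphism $\theta : G_q \to GL_m(K)$, and for every topological generator $\tau_q$ of the tame inertia subgroup $I_q/P_q$ of $G_q$, the matrix $\rho(\tau_q) := \theta(\tau_q)$ is unipotent, i.e. $\theta(\tau_q) - 1$ is nilpotent. -/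

import Mathlib

open scoped NumberField Pointwise

namespace ValuationSubring

variable (F : Type*) {E : Type*} [Field F] [Field E] [Algebra F E]

/-- Elements of the decomposition group preserve the maximal ideal of `A`. -/
theorem apply_mem_nonunits_of_decomposition (A : ValuationSubring E)
    (g : A.decompositionSubgroup F) {x : E} (hx : x ∈ A.nonunits) :
    (g : E ≃ₐ[F] E) x ∈ A.nonunits := by
  rw [mem_nonunits_iff_or] at hx ⊢
  rcases hx with rfl | hx
  · exact Or.inl (map_zero _)
  · refine Or.inr fun h => hx ?_
    have hg : (g : E ≃ₐ[F] E) • A = A := g.2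
    have h' : (g : E ≃ₐ[F] E) • x⁻¹ ∈ (g : E ≃ₐ[F] E) • A := by
      rw [AlgEquiv.smul_def, map_inv₀]
      exact hg.symm ▸ h
    exact smul_mem_pointwise_smul_iff.mp h'

/-- The wild inertia group (the ramification group) of `A` in its decomposition group: all `σ` such
that `σ x / x ≡ 1` modulo the maximal ideal of `A`, for every `x ≠ 0` in the field. -/
def wildInertiaSubgroup (A : ValuationSubring E) : Subgroup (A.decompositionSubgroup F) where
  carrier := {σ | ∀ x : E, x ≠ 0 → (σ : E ≃ₐ[F] E) x / x - 1 ∈ A.nonunits}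
  one_mem' := by
    intro x hx
    simp [hx]
  mul_mem' := by
    intro σ τ hσ hτ x hx
    have hy : (τ : E ≃ₐ[F] E) x ≠ 0 := by simpa using hx
    have h1 := hσ _ hy
    have h2 := hτ x hx
    have key : ((σ * τ : A.decompositionSubgroup F) : E ≃ₐ[F] E) x / x - 1 =
        ((σ : E ≃ₐ[F] E) ((τ : E ≃ₐ[F] E) x) / (τ : E ≃ₐ[F] E) x - 1) *
          ((τ : E ≃ₐ[F] E) x / x - 1) +
        (((σ : E ≃ₐ[F] E) ((τ : E ≃ₐ[F] E) x) / (τ : E ≃ₐ[F] E) x - 1) +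
          ((τ : E ≃ₐ[F] E) x / x - 1)) := by
      rw [Subgroup.coe_mul, AlgEquiv.mul_apply]
      field_simp
      ring
    rw [key]
    exact A.nonunits.add_mem (A.nonunits.mul_mem h1 h2) (A.nonunits.add_mem h1 h2)
  inv_mem' := by
    intro σ hσ x hx
    have hy : (σ : E ≃ₐ[F] E).symm x ≠ 0 := by simpa using hx
    have h := hσ _ hy
    rw [AlgEquiv.apply_symm_apply] at h
    have hv : A.valuation (x / (σ : E ≃ₐ[F] E).symm x) = 1 := by
      rw [mem_nonunits_iff] at h
      have := Valuation.map_one_add_of_lt (v := A.valuation) h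
      simpa using this
    have key : ((σ⁻¹ : A.decompositionSubgroup F) : E ≃ₐ[F] E) x / x - 1 =
        -((x / (σ : E ≃ₐ[F] E).symm x - 1) / (x / (σ : E ≃ₐ[F] E).symm x)) := by
      change (σ : E ≃ₐ[F] E).symm x / x - 1 = _
      field_simp
      ring
    rw [key, mem_nonunits_iff, Valuation.map_neg, map_div₀, hv, div_one]
    exact h

instance wildInertiaSubgroup_normal (A : ValuationSubring E) :
    (A.wildInertiaSubgroup F).Normal where
  conj_mem := by
    intro σ hσ g
    change ∀ x : E, x ≠ 0 →
      (g : E ≃ₐ[F] E) ((σ : E ≃ₐ[F] E) ((g : E ≃ₐ[F] E).symm x)) / x - 1 ∈ A.nonunits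
    intro x hx
    have hy : (g : E ≃ₐ[F] E).symm x ≠ 0 := by simpa using hx
    have h := A.apply_mem_nonunits_of_decomposition F g (hσ _ hy)
    rw [map_sub, map_one, map_div₀, AlgEquiv.apply_symm_apply] at h
    exact h

/-- The quotient of the decomposition group by wild inertia. For a place of an algebraic closure
above a finite place of a number field, this is the Galois group of the maximal tamely ramified
extension of the completion at that finite place. It carries the quotient topology. -/
abbrev TameDecompositionGroup (A : ValuationSubring E) : Type _ :=
  A.decompositionSubgroup F ⧸ A.wildInertiaSubgroup F

/-- The tame inertia group: the image of inertia in the tame decomposition group. -/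
noncomputable def tameInertiaSubgroup (A : ValuationSubring E) : Subgroup (A.TameDecompositionGroup F) :=
  (A.inertiaSubgroup F).map (QuotientGroup.mk' (A.wildInertiaSubgroup F))

/-- `τ` topologically generates tame inertia. -/
def IsTameInertiaGenerator (A : ValuationSubring E) (τ : A.TameDecompositionGroup F) : Prop :=
  (Subgroup.zpowers τ).topologicalClosure = A.tameInertiaSubgroup F

end ValuationSubring

/-- `A`, a valuation ring of an algebraic closure of the number field `L` (that is, a place of
`AlgebraicClosure L`), lies above the prime `q` of `L`: it cuts out on `L` the valuation ring
of the `q`-adic valuation. -/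
def IsPlaceAbove {L : Type*} [Field L] [NumberField L]
    (A : ValuationSubring (AlgebraicClosure L))
    (q : IsDedekindDomain.HeightOneSpectrum (𝓞 L)) : Prop :=
  A.comap (algebraMap L (AlgebraicClosure L)) = (q.valuation L).valuationSubring

/-- The linear representation on column vectors attached to a homomorphism to `GL_m`. -/
def glRepresentation {G K : Type*} [Group G] [Field K] {m : ℕ}
    (ρ : G →* GL (Fin m) K) : Representation K G (Fin m → K) where
  toFun g := Matrix.toLin' (ρ g : Matrix (Fin m) (Fin m) K)
  map_one' := by simp [Module.End.one_eq_id]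
  map_mul' g h := by simp [Matrix.toLin'_mul, Module.End.mul_eq_comp]

/-- An invertible matrix `g` is unipotent if `g - 1` is nilpotent. -/
def IsUnipotentMatrix {K : Type*} [Field K] {m : ℕ} (g : GL (Fin m) K) : Prop :=
  IsNilpotent ((g : Matrix (Fin m) (Fin m) K) - 1)

/-! ### Powers of elements close to `1` in an ultrametric ring. -/

section UltrametricRing

variable {k R : Type*} [NormedField k] [NormedRing R]

/-! By continuity some finite extension `M` of `L` has `ρ(Gal(L̄/M))` inside the ball `‖x - 1‖ <
‖p‖`. Discard the finitely many `q` that divide `p` or at which inertia moves `M`; for the others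
`ρ` sends inertia into this ball.

Wild inertia dies: it has no torsion prime to the residue characteristic, so, modulo any open
subgroup, powers prime to `p` suffice to kill it, and such powers do not shrink the distance to `1`
(`map_eq_one_of_mem_wildInertiaSubgroup`).

On tame inertia a Frobenius `φ` gives `φτφ⁻¹ = τ ^ N` modulo wild inertia
(`IsPlaceAbove.exists_frobenius`, `conj_mul_pow_inv_mem_wildInertiaSubgroup`). So `λ ↦ λ ^ N`
permutes the eigenvalues of `ρ(τ)`, which are therefore roots of unity, and a power of `ρ(τ)` is
unipotent. Inside the ball of radius `‖p‖` this forces `ρ(τ)` itself to be unipotent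
(`isNilpotent_sub_one_of_pow_of_norm_lt_prime`). -/

theorem norm_natCast_inv_smul [NormedAlgebra k R] (n : ℕ) (x : R) : ‖(n : k)⁻¹ • x‖ = ‖(n : k)‖⁻¹ * ‖x‖ := by
  rw [norm_smul, norm_inv]

variable [IsUltrametricDist R]

theorem norm_pow_sub_one_le (h1 : ‖(1 : R)‖ ≤ 1) {g : R} (hg : ‖g - 1‖ ≤ 1) (n : ℕ) :
    ‖g ^ n - 1‖ ≤ ‖g - 1‖ := by
  have hg1 : ‖g‖ ≤ 1 := by
    have := IsUltrametricDist.norm_add_le_max (g - 1) 1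
    rw [sub_add_cancel] at this
    exact this.trans (max_le hg h1)
  induction n with
  | zero => simp
  | succ n ih =>
    have key : g ^ (n + 1) - 1 = (g ^ n - 1) * g + (g - 1) := by rw [pow_succ]; noncomm_ring
    rw [key]
    refine (IsUltrametricDist.norm_add_le_max _ _).trans (max_le ?_ le_rfl)
    exact (norm_mul_le _ _).trans ((mul_le_of_le_one_right (norm_nonneg _) hg1).trans ih)

theorem norm_sum_pow_sub_one_le (h1 : ‖(1 : R)‖ ≤ 1) {g : R} (hg : ‖g - 1‖ ≤ 1) (n : ℕ) :
    ‖∑ i ∈ Finset.range n, (g ^ i - 1)‖ ≤ ‖g - 1‖ :=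
  IsUltrametricDist.norm_sum_le_of_forall_le_of_nonneg (norm_nonneg _)
    fun i _ => norm_pow_sub_one_le h1 hg i

variable [NormedAlgebra k R]

/-- In `g ^ n - 1 = (n + s)(g - 1)` the term `s` has norm `< 1`, so the linear term `n (g - 1)`
dominates. -/
theorem norm_sub_one_le_norm_pow_sub_one (h1 : ‖(1 : R)‖ ≤ 1) {g : R} (hg : ‖g - 1‖ < 1) {n : ℕ}
    (hn : ‖(n : k)‖ = 1) : ‖g - 1‖ ≤ ‖g ^ n - 1‖ := by
  by_contra! hlt
  have hn0 : (n : k) ≠ 0 := by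
    intro h
    simp [h] at hn
  set s := ∑ i ∈ Finset.range n, (g ^ i - 1) with hs
  have hsum : (∑ i ∈ Finset.range n, g ^ i) = (n : k) • (1 : R) + s := by
    rw [hs, Finset.sum_sub_distrib]
    simp [Nat.cast_smul_eq_nsmul]
  have key : (n : k) • (g - 1) = (g ^ n - 1) - s * (g - 1) := by
    rw [← geom_sum_mul, hsum, add_mul, smul_mul_assoc, one_mul]
    abel
  have hnorm : ‖g - 1‖ = ‖(g ^ n - 1) - s * (g - 1)‖ := by
    rw [← key, norm_smul, hn, one_mul]
  have hpos : 0 < ‖g - 1‖ := (norm_nonneg _).trans_lt hlt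
  have hs' : ‖s * (g - 1)‖ < ‖g - 1‖ := by
    refine (norm_mul_le _ _).trans_lt (mul_lt_of_lt_one_left hpos ?_)
    exact (norm_sum_pow_sub_one_le h1 hg.le n).trans_lt hg
  have := IsUltrametricDist.norm_add_le_max (g ^ n - 1) (-(s * (g - 1)))
  rw [← sub_eq_add_neg, ← hnorm, norm_neg] at this
  exact absurd this (not_le.mpr (max_lt hlt hs'))

/-- The sum is `n (1 + s / n)` with `‖s / n‖ < 1`, so a Neumann series inverts it. This lets `g ^ n
- 1` be divided down to `g - 1`. -/
theorem isUnit_geom_sum_of_norm_lt [CompleteSpace R] (h1 : ‖(1 : R)‖ ≤ 1) {g : R} {n : ℕ}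
    (hn : ‖(n : k)‖ ≤ 1) (hg : ‖g - 1‖ < ‖(n : k)‖) : IsUnit (∑ i ∈ Finset.range n, g ^ i) := by
  have hpos : 0 < ‖(n : k)‖ := (norm_nonneg _).trans_lt hg
  have hn0 : (n : k) ≠ 0 := norm_pos_iff.mp hpos
  set s := ∑ i ∈ Finset.range n, (g ^ i - 1) with hs
  have hsum : (∑ i ∈ Finset.range n, g ^ i) = (n : k) • (1 - -((n : k)⁻¹ • s)) := by
    rw [sub_neg_eq_add, smul_add, smul_inv_smul₀ hn0, hs, Finset.sum_sub_distrib]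
    simp [Nat.cast_smul_eq_nsmul]
  have hlt : ‖-((n : k)⁻¹ • s)‖ < 1 := by
    rw [norm_neg, norm_natCast_inv_smul, inv_mul_lt_one₀ hpos]
    exact (norm_sum_pow_sub_one_le h1 (hg.le.trans hn) n).trans_lt hg
  rw [hsum, Algebra.smul_def]
  exact ((isUnit_iff_ne_zero.mpr hn0).map (algebraMap k R)).mul (isUnit_one_sub_of_norm_lt_one hlt)

theorem isNilpotent_sub_one_of_pow [CompleteSpace R] (h1 : ‖(1 : R)‖ ≤ 1) {g : R} {n : ℕ}
    (hn : ‖(n : k)‖ ≤ 1) (hg : ‖g - 1‖ < ‖(n : k)‖) (h : IsNilpotent (g ^ n - 1)) :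
    IsNilpotent (g - 1) := by
  have hu := isUnit_geom_sum_of_norm_lt h1 hn hg
  have hc : Commute (∑ i ∈ Finset.range n, g ^ i) (g - 1) := by
    refine Commute.sum_left _ _ _ fun i _ => ?_
    exact ((Commute.refl g).pow_left i).sub_right (Commute.one_right _)
  rw [← geom_sum_mul] at h
  exact (hu.isNilpotent_unit_mul_of_commute_iff hc.symm).mp h

end UltrametricRing

/-! ### Integers in extensions of `ℚ_[p]`. -/

section PadicField

theorem norm_natCast_eq_padic (p : ℕ) [Fact p.Prime] (K : Type*) [NormedField K]
    [NormedAlgebra ℚ_[p] K] (n : ℕ) : ‖(n : K)‖ = ‖(n : ℚ_[p])‖ := by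
  rw [← map_natCast (algebraMap ℚ_[p] K), norm_algebraMap']

theorem norm_natCast_le_one_of_padic (p : ℕ) [Fact p.Prime] (K : Type*) [NormedField K]
    [NormedAlgebra ℚ_[p] K] (n : ℕ) : ‖(n : K)‖ ≤ 1 := by
  rw [norm_natCast_eq_padic p K]
  exact_mod_cast Padic.norm_int_le_one (p := p) n

theorem norm_natCast_eq_one_of_not_dvd (p : ℕ) [Fact p.Prime] (K : Type*) [NormedField K]
    [NormedAlgebra ℚ_[p] K] {n : ℕ} (hn : ¬ p ∣ n) : ‖(n : K)‖ = 1 := by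
  refine le_antisymm (norm_natCast_le_one_of_padic p K n) ?_
  rw [norm_natCast_eq_padic p K]
  by_contra! h
  exact hn (by exact_mod_cast (Padic.norm_intCast_lt_one_iff (p := p) (k := n)).mp (by exact_mod_cast h))

theorem norm_prime_natCast_lt_one (p : ℕ) [Fact p.Prime] (K : Type*) [NormedField K]
    [NormedAlgebra ℚ_[p] K] : ‖(p : K)‖ < 1 := by
  rw [norm_natCast_eq_padic p K]
  exact Padic.norm_p_lt_one

theorem norm_prime_natCast_pos (p : ℕ) [Fact p.Prime] (K : Type*) [NormedField K]
    [NormedAlgebra ℚ_[p] K] : 0 < ‖(p : K)‖ := by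
  rw [norm_natCast_eq_padic p K, norm_pos_iff]
  exact_mod_cast (Fact.out : p.Prime).ne_zero

theorem isUltrametricDist_of_padic (p : ℕ) [Fact p.Prime] (K : Type*) [NormedField K]
    [NormedAlgebra ℚ_[p] K] : IsUltrametricDist K :=
  IsUltrametricDist.isUltrametricDist_of_forall_norm_natCast_le_one
    (norm_natCast_le_one_of_padic p K)

theorem isNilpotent_sub_one_of_pow_of_norm_lt_prime {p : ℕ} [Fact p.Prime] {K : Type*}
    [NormedField K] [NormedAlgebra ℚ_[p] K] {R : Type*} [NormedRing R] [NormedAlgebra K R]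
    [IsUltrametricDist R] [CompleteSpace R] (h1 : ‖(1 : R)‖ ≤ 1) {n : ℕ} (hn : n ≠ 0) {g : R}
    (hg : ‖g - 1‖ < ‖(p : K)‖) (h : IsNilpotent (g ^ n - 1)) : IsNilpotent (g - 1) := by
  -- The bound `‖g - 1‖ < ‖n‖` can fail when a high power of `p` divides `n`. Removing one prime
  -- factor at a time needs only radius `‖p‖`, since powers of `g` stay in the ball.
  induction n using Nat.recOnMul generalizing g with
  | zero => exact absurd rfl hn
  | one => simpa using h
  | prime l hl =>
    refine isNilpotent_sub_one_of_pow (k := K) h1 (norm_natCast_le_one_of_padic p K l) ?_ h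
    by_cases hpl : p ∣ l
    · rwa [← (Nat.prime_dvd_prime_iff_eq Fact.out hl).mp hpl]
    · rw [norm_natCast_eq_one_of_not_dvd p K hpl]
      exact hg.trans (norm_prime_natCast_lt_one p K)
  | mul a b iha ihb =>
    have ha : a ≠ 0 := left_ne_zero_of_mul hn
    have hb : b ≠ 0 := right_ne_zero_of_mul hn
    refine iha ha hg (ihb hb ?_ (by rwa [← pow_mul]))
    exact (norm_pow_sub_one_le h1 (hg.trans (norm_prime_natCast_lt_one p K)).le a).trans_lt hg

end PadicField

/-! ### Entrywise supremum norm on matrices. -/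

section MatrixNorm

attribute [local instance] Matrix.normedAddCommGroup Matrix.normedSpace

variable {n k : Type*} [Fintype n] [NormedField k]

theorem Matrix.norm_mul_le_of_isUltrametricDist [IsUltrametricDist k] (a b : Matrix n n k) : ‖a * b‖ ≤ ‖a‖ * ‖b‖ := by
  refine (Matrix.norm_le_iff (mul_nonneg (norm_nonneg _) (norm_nonneg _))).mpr fun i j => ?_
  rw [Matrix.mul_apply]
  refine IsUltrametricDist.norm_sum_le_of_forall_le_of_nonneg
    (mul_nonneg (norm_nonneg _) (norm_nonneg _)) fun l _ => ?_
  rw [norm_mul]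
  exact mul_le_mul (Matrix.norm_entry_le_entrywise_sup_norm a)
    (Matrix.norm_entry_le_entrywise_sup_norm b) (norm_nonneg _) (norm_nonneg _)

variable (n k) in
/-- The supremum norm of the entries makes matrices over an ultrametric field a normed ring. -/
abbrev Matrix.ultrametricNormedRing [DecidableEq n] [IsUltrametricDist k] : NormedRing (Matrix n n k) where
  __ := (inferInstance : NormedAddCommGroup (Matrix n n k))
  __ := (inferInstance : Ring (Matrix n n k))
  dist_eq := NormedAddCommGroup.dist_eq
  norm_mul_le := Matrix.norm_mul_le_of_isUltrametricDist

variable (n k) in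
/-- Matrices over an ultrametric field form a normed algebra for the supremum norm. -/
abbrev Matrix.ultrametricNormedAlgebra [DecidableEq n] [IsUltrametricDist k] :
    letI := Matrix.ultrametricNormedRing n k
    NormedAlgebra k (Matrix n n k) :=
  letI := Matrix.ultrametricNormedRing n k
  { (inferInstance : Algebra k (Matrix n n k)) with
    norm_smul_le := fun a b => norm_smul_le a b }

/-- Only an inequality: for matrices of size `0` the norm of `1` is `0`. -/
theorem Matrix.norm_one_le_one [DecidableEq n] : ‖(1 : Matrix n n k)‖ ≤ 1 := by
  refine (Matrix.norm_le_iff zero_le_one).mpr fun i j => ?_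
  rw [Matrix.one_apply]
  split_ifs <;> simp

theorem Matrix.isUltrametricDist [IsUltrametricDist k] : IsUltrametricDist (Matrix n n k) :=
  inferInstanceAs (IsUltrametricDist (n → n → k))

end MatrixNorm

/-! ### Eigenvalues of a matrix conjugate to its own power. -/

section Spectrum

theorem Matrix.isNilpotent_of_spectrum_subset {k : Type*} [Field k] [IsAlgClosed k] {n : Type*}
    [Fintype n] [DecidableEq n] {a : Matrix n n k} (ha : ∀ x ∈ spectrum k a, x = 0) :
    IsNilpotent a := by
  have hroots : ∀ x ∈ a.charpoly.roots, x = 0 := fun x hx =>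
    ha x (Matrix.mem_spectrum_of_isRoot_charpoly ((Polynomial.mem_roots'.mp hx).2))
  have hsplit := IsAlgClosed.splits a.charpoly
  have hX : a.charpoly = Polynomial.X ^ (Multiset.card a.charpoly.roots) := by
    conv_lhs => rw [hsplit.eq_prod_roots_of_monic (Matrix.charpoly_monic a)]
    rw [Multiset.eq_replicate_card.mpr hroots]
    simp
  refine ⟨Multiset.card a.charpoly.roots, ?_⟩
  have := Matrix.aeval_self_charpoly a
  rw [hX] at this
  simpa using this

/-- A surjective self-map of a finite set is a permutation; `r` is its order. -/
theorem exists_pow_eq_self_of_image_pow_eq {k : Type*} [Monoid k] {s : Set k} (hs : s.Finite)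
    {n : ℕ} (h : (· ^ n) '' s = s) : ∃ r, 0 < r ∧ ∀ x ∈ s, x ^ n ^ r = x := by
  have hmaps : Set.MapsTo (· ^ n) s s := Set.mapsTo_iff_image_subset.mpr h.subset
  have : Finite s := hs
  let f : s → s := hmaps.restrict
  have hsurj : Function.Surjective f := by
    rintro ⟨y, hy⟩
    obtain ⟨x, hx, hxy⟩ := h.superset hy
    exact ⟨⟨x, hx⟩, Subtype.ext hxy⟩
  let e : Equiv.Perm s := Equiv.ofBijective f (Finite.surjective_iff_bijective.mp hsurj)
  have hiter : ∀ (r : ℕ) (x : s), ((e ^ r) x : k) = (x : k) ^ n ^ r := by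
    intro r x
    induction r with
    | zero => simp
    | succ r ih =>
      rw [pow_succ', Equiv.Perm.mul_apply]
      change ((e ^ r) x : k) ^ n = _
      rw [ih, ← pow_mul, pow_succ]
  refine ⟨orderOf e, orderOf_pos e, fun x hx => ?_⟩
  rw [← hiter (orderOf e) ⟨x, hx⟩, pow_orderOf_eq_one]
  rfl

/-- Conjugation preserves the spectrum, so `N`-th powers permute the eigenvalues. If the `r`-th
iterate fixes them all, each satisfies `λ ^ (N ^ r - 1) = 1`. -/
theorem Matrix.exists_isNilpotent_pow_sub_one_of_conj {k : Type*} [Field k] {n : Type*} [Fintype n]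
    [DecidableEq n] {g h : GL n k} {N : ℕ} (hN : 2 ≤ N) (hgh : h * g * h⁻¹ = g ^ N) :
    ∃ M, M ≠ 0 ∧ IsNilpotent ((g : Matrix n n k) ^ M - 1) := by
  cases isEmpty_or_nonempty n
  · exact ⟨1, one_ne_zero, 1, Subsingleton.elim _ _⟩
  let F := AlgebraicClosure k
  let ι : Matrix n n k →+* Matrix n n F := (algebraMap k F).mapMatrix
  let g' : (Matrix n n F)ˣ := Units.map ι.toMonoidHom g
  let h' : (Matrix n n F)ˣ := Units.map ι.toMonoidHom h
  have hgh' : h' * g' * h'⁻¹ = g' ^ N := by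
    simp only [g', h', ← map_inv, ← map_mul, ← map_pow]
    exact congrArg _ hgh
  let S := spectrum F (g' : Matrix n n F)
  have hS : (· ^ N) '' S = S := by
    have h1 := spectrum.map_pow_of_pos (𝕜 := F) (g' : Matrix n n F) (by lia : 0 < N)
    rw [← h1, ← Units.val_pow_eq_pow_val, ← hgh']
    simp only [Units.val_mul]
    exact spectrum.units_conjugate
  obtain ⟨r, hr, hfix⟩ := exists_pow_eq_self_of_image_pow_eq (Matrix.finite_spectrum _) hS
  have hNr : 1 < N ^ r := Nat.one_lt_pow hr.ne' hN
  refine ⟨N ^ r - 1, by lia, ?_⟩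
  have hnil : IsNilpotent (ι ((g : Matrix n n k) ^ (N ^ r - 1) - 1)) := by
    refine Matrix.isNilpotent_of_spectrum_subset fun x hx => ?_
    have hp : ι ((g : Matrix n n k) ^ (N ^ r - 1) - 1) =
        Polynomial.aeval (g' : Matrix n n F) (Polynomial.X ^ (N ^ r - 1) - 1 : Polynomial F) := by
      simp [g']
    rw [hp, spectrum.map_polynomial_aeval_of_nonempty _ _
      (spectrum.nonempty_of_isAlgClosed_of_finiteDimensional F _)] at hx
    obtain ⟨y, hy, rfl⟩ := hx
    have hy0 : y ≠ 0 := spectrum.ne_zero_of_mem_of_unit hy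
    have hy1 := hfix y hy
    have : y ^ (N ^ r - 1) = 1 := by
      apply mul_right_cancel₀ hy0
      rw [← pow_succ, Nat.sub_add_cancel hNr.le, hy1, one_mul]
    simp [this]
  have hinj : Function.Injective ι := Matrix.map_injective (algebraMap k F).injective
  obtain ⟨e, he⟩ := hnil
  exact ⟨e, hinj (by rw [map_pow, he, map_zero])⟩

end Spectrum

/-! ### Finiteness of Galois orbits. -/

section GaloisOrbits

variable {F E : Type*} [Field F] [Field E] [Algebra F E] [IsGalois F E]

theorem Subgroup.exists_pow_mem_of_isOpen_of_compactSpace {G : Type*} [Group G]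
    [TopologicalSpace G] [ContinuousMul G] [CompactSpace G] {H : Subgroup G}
    (hH : IsOpen (H : Set G)) (g : G) : ∃ n, 0 < n ∧ g ^ n ∈ H := by
  have : Finite (G ⧸ H) := Subgroup.quotient_finite_of_isOpen H hH
  have hi : H.index ≠ 0 := Subgroup.index_ne_zero_of_finite
  obtain ⟨n, hn, -, h⟩ := Subgroup.exists_pow_mem_of_index_ne_zero hi g
  exact ⟨n, hn, h⟩

theorem AlgEquiv.exists_pow_apply_eq_self (σ : Gal(E/F)) (x : E) :
    ∃ n, 0 < n ∧ (σ ^ n) x = x := by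
  obtain ⟨n, hn, h⟩ := Subgroup.exists_pow_mem_of_isOpen_of_compactSpace
    (stabilizer_isOpen_of_isIntegral (K := F) x) σ
  exact ⟨n, hn, h⟩

end GaloisOrbits

/-! ### Decomposition, inertia and the tame relation. -/

namespace ValuationSubring

variable {F E : Type*} [Field F] [Field E] [Algebra F E] {A : ValuationSubring E}

theorem apply_mem_of_decomposition (g : A.decompositionSubgroup F) {x : E} (hx : x ∈ A) :
    (g : Gal(E/F)) x ∈ A := by
  have hg : (g : Gal(E/F)) • A = A := g.2
  have h := smul_mem_pointwise_smul (g : Gal(E/F)) x A hx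
  rwa [hg] at h

theorem valuation_apply_le_of_decomposition (g : A.decompositionSubgroup F) {x y : E}
    (h : A.valuation x ≤ A.valuation y) :
    A.valuation ((g : Gal(E/F)) x) ≤ A.valuation ((g : Gal(E/F)) y) := by
  obtain ⟨a, rfl⟩ := (A.valuation_le_iff x y).mp h
  exact (A.valuation_le_iff _ _).mpr
    ⟨⟨_, A.apply_mem_of_decomposition g a.2⟩, (map_mul (g : Gal(E/F)) _ _).symm⟩

/-- The valuation is monotone along the orbit of `x`, which returns to `x`, so it is constant. -/
theorem valuation_apply_of_decomposition [IsGalois F E] (g : A.decompositionSubgroup F) (x : E) :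
    A.valuation ((g : Gal(E/F)) x) = A.valuation x := by
  obtain ⟨n, hn, hx⟩ := AlgEquiv.exists_pow_apply_eq_self (g : Gal(E/F)) x
  have hsucc : ∀ k, ((g : Gal(E/F)) ^ (k + 1)) x = ((g : Gal(E/F)) ^ k) ((g : Gal(E/F)) x) :=
    fun k => by rw [pow_succ, AlgEquiv.mul_apply]
  rcases le_total (A.valuation ((g : Gal(E/F)) x)) (A.valuation x) with h | h
  · have hanti : Antitone fun k : ℕ => A.valuation (((g : Gal(E/F)) ^ k) x) := by
      refine antitone_nat_of_succ_le fun k => ?_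
      rw [hsucc]
      exact valuation_apply_le_of_decomposition (g ^ k) h
    refine le_antisymm h ?_
    have := hanti (Nat.one_le_iff_ne_zero.mpr hn.ne')
    simpa [hx] using this
  · have hmono : Monotone fun k : ℕ => A.valuation (((g : Gal(E/F)) ^ k) x) := by
      refine monotone_nat_of_le_succ fun k => ?_
      rw [hsucc]
      exact valuation_apply_le_of_decomposition (g ^ k) h
    refine le_antisymm ?_ h
    have := hmono (Nat.one_le_iff_ne_zero.mpr hn.ne')
    simpa [hx] using this

/-- The action of the decomposition group on the units of the field. -/
def decompositionUnitsHom (g : A.decompositionSubgroup F) : Eˣ →* Eˣ :=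
  Units.map ((g : Gal(E/F)) : E →* E)

@[simp]
theorem coe_decompositionUnitsHom (g : A.decompositionSubgroup F) (x : Eˣ) :
    (decompositionUnitsHom g x : E) = (g : Gal(E/F)) x := rfl

theorem decompositionUnitsHom_mul_apply (g h : A.decompositionSubgroup F) (x : Eˣ) :
    decompositionUnitsHom (g * h) x = decompositionUnitsHom g (decompositionUnitsHom h x) := rfl

theorem decompositionUnitsHom_inv_apply (g : A.decompositionSubgroup F) (x : Eˣ) :
    decompositionUnitsHom g (decompositionUnitsHom g⁻¹ x) = x := by
  rw [← decompositionUnitsHom_mul_apply, mul_inv_cancel]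
  rfl

theorem decompositionUnitsHom_div_mem_unitGroup [IsGalois F E] (g : A.decompositionSubgroup F)
    (x : Eˣ) : decompositionUnitsHom g x / x ∈ A.unitGroup := by
  rw [mem_unitGroup_iff, Units.val_div_eq_div_val, map_div₀, coe_decompositionUnitsHom,
    valuation_apply_of_decomposition, div_self]
  simp

theorem mem_wildInertiaSubgroup_iff (g : A.decompositionSubgroup F) :
    g ∈ A.wildInertiaSubgroup F ↔
      ∀ x : Eˣ, decompositionUnitsHom g x / x ∈ A.principalUnitGroup := by
  constructor
  · intro h x
    rw [mem_principalUnitGroup_iff, Units.val_div_eq_div_val]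
    exact h x x.ne_zero
  · intro h x hx
    have := h (Units.mk0 x hx)
    rwa [mem_principalUnitGroup_iff, Units.val_div_eq_div_val] at this

theorem apply_sub_mem_nonunits_of_mem_inertia {g : A.decompositionSubgroup F}
    (hg : g ∈ A.inertiaSubgroup F) {x : E} (hx : x ∈ A) :
    (g : Gal(E/F)) x - x ∈ A.nonunits := by
  have h : g • IsLocalRing.residue A ⟨x, hx⟩ = IsLocalRing.residue A ⟨x, hx⟩ :=
    DFunLike.congr_fun (MonoidHom.mem_ker.mp hg) _
  rw [← IsLocalRing.ResidueField.residue_smul, ← sub_eq_zero, ← map_sub,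
    IsLocalRing.residue_eq_zero_iff] at h
  exact coe_mem_nonunits_iff.mpr h

theorem div_mem_principalUnitGroup_of_sub_mem_nonunits {x y : Eˣ} (hy : y ∈ A.unitGroup)
    (h : (x : E) - y ∈ A.nonunits) : x / y ∈ A.principalUnitGroup := by
  rw [mem_principalUnitGroup_iff, Units.val_div_eq_div_val, div_sub_one y.ne_zero, map_div₀,
    (A.mem_unitGroup_iff y).mp hy, div_one]
  exact h

theorem decompositionUnitsHom_div_mem_of_mem_inertia {g : A.decompositionSubgroup F}
    (hg : g ∈ A.inertiaSubgroup F) {w : Eˣ} (hw : w ∈ A.unitGroup) :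
    decompositionUnitsHom g w / w ∈ A.principalUnitGroup := by
  refine div_mem_principalUnitGroup_of_sub_mem_nonunits hw ?_
  exact apply_sub_mem_nonunits_of_mem_inertia hg
    ((A.valuation_le_one_iff _).mp ((A.mem_unitGroup_iff w).mp hw).le)

section FrobeniusRelation

/-- Inertia fixes residues, so the class of `g x / x` depends on `x` only modulo units of `A`. -/
theorem mk_decompositionUnitsHom_of_mem_inertia {g : A.decompositionSubgroup F}
    (hg : g ∈ A.inertiaSubgroup F) {x y : Eˣ} (hxy : x / y ∈ A.unitGroup) :
    (QuotientGroup.mk (decompositionUnitsHom g x / x) : Eˣ ⧸ A.principalUnitGroup) =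
      QuotientGroup.mk (decompositionUnitsHom g y / y) := by
  have h := decompositionUnitsHom_div_mem_of_mem_inertia hg hxy
  rw [map_div, div_div_div_comm] at h
  rw [← div_eq_one, ← QuotientGroup.mk_div]
  exact (QuotientGroup.eq_one_iff _).mpr h

variable [IsGalois F E]

theorem mk_decompositionUnitsHom_pow_of_mem_inertia {g : A.decompositionSubgroup F}
    (hg : g ∈ A.inertiaSubgroup F) (x : Eˣ) (n : ℕ) :
    (QuotientGroup.mk (decompositionUnitsHom (g ^ n) x / x) : Eˣ ⧸ A.principalUnitGroup) =
      QuotientGroup.mk (decompositionUnitsHom g x / x) ^ n := by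
  induction n with
  | zero =>
    rw [pow_zero, pow_zero, QuotientGroup.eq_one_iff]
    have : decompositionUnitsHom (1 : A.decompositionSubgroup F) x = x := rfl
    rw [this, div_self']
    exact A.principalUnitGroup.one_mem
  | succ n ih =>
    have h := mk_decompositionUnitsHom_of_mem_inertia hg
      (decompositionUnitsHom_div_mem_unitGroup (g ^ n) x)
    have key : decompositionUnitsHom (g ^ (n + 1)) x / x =
        (decompositionUnitsHom g (decompositionUnitsHom (g ^ n) x) /
          decompositionUnitsHom (g ^ n) x) * (decompositionUnitsHom (g ^ n) x / x) := by
      rw [pow_succ' g, decompositionUnitsHom_mul_apply, div_mul_div_cancel]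
    rw [key, QuotientGroup.mk_mul, ih, h, pow_succ']

/-- An element of the decomposition group acting as `N`-th power on the residue field
conjugates tame inertia by raising to the `N`-th power. -/
theorem conj_mul_pow_inv_mem_wildInertiaSubgroup {φ τ : A.decompositionSubgroup F} {N : ℕ}
    (hφ : ∀ w ∈ A.unitGroup, decompositionUnitsHom φ w / w ^ N ∈ A.principalUnitGroup)
    (hτ : τ ∈ A.inertiaSubgroup F) :
    φ * τ * φ⁻¹ * (τ ^ N)⁻¹ ∈ A.wildInertiaSubgroup F := by
  rw [mem_wildInertiaSubgroup_iff]
  intro x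
  obtain ⟨u, rfl⟩ : ∃ u, decompositionUnitsHom (τ ^ N) u = x :=
    ⟨_, decompositionUnitsHom_inv_apply (τ ^ N) x⟩
  obtain ⟨y, rfl⟩ : ∃ y, decompositionUnitsHom φ y = u :=
    ⟨_, decompositionUnitsHom_inv_apply φ u⟩
  set u := decompositionUnitsHom φ y with hu
  have hyu : y / u ∈ A.unitGroup := by
    rw [← inv_div]
    exact inv_mem (decompositionUnitsHom_div_mem_unitGroup φ y)
  have hleft : decompositionUnitsHom (φ * τ * φ⁻¹ * (τ ^ N)⁻¹) (decompositionUnitsHom (τ ^ N) u) =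
      decompositionUnitsHom φ (decompositionUnitsHom τ y) := by
    rw [hu, ← decompositionUnitsHom_mul_apply, ← decompositionUnitsHom_mul_apply,
      ← decompositionUnitsHom_mul_apply]
    congr 1
    group
  rw [hleft, ← QuotientGroup.eq_one_iff]
  -- Modulo principal units, `φ(τy/y) ≡ (τy/y) ^ N ≡ (τu/u) ^ N ≡ τ ^ N u / u`, while the left side
  -- is `φτy / u`.
  have hfrob := hφ _ (decompositionUnitsHom_div_mem_unitGroup τ y)
  rw [← QuotientGroup.eq_one_iff, QuotientGroup.mk_div, div_eq_one, QuotientGroup.mk_pow,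
    mk_decompositionUnitsHom_of_mem_inertia hτ hyu,
    ← mk_decompositionUnitsHom_pow_of_mem_inertia hτ, map_div, ← hu] at hfrob
  rw [← div_div_div_cancel_right _ _ u, QuotientGroup.mk_div, hfrob, div_self']

end FrobeniusRelation

/-- Wild inertia has no torsion prime to the residue characteristic. -/
theorem apply_eq_self_of_mem_wildInertiaSubgroup {τ : A.decompositionSubgroup F}
    (hτ : τ ∈ A.wildInertiaSubgroup F) {n : ℕ} (hn : (n : E) ∉ A.nonunits) {x : E}
    (hx : ((τ : Gal(E/F)) ^ n) x = x) : (τ : Gal(E/F)) x = x := by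
  have hn0 : (n : E) ≠ 0 := fun h => hn (h ▸ A.nonunits.zero_mem)
  -- The trace over the `τ`-orbit: `y = x - t x / n` has trace `0`. If `y ≠ 0`, dividing by `y`
  -- writes `n` as a sum of terms `1 - τ ^ i y / y`, all nonunits.
  let t : E → E := fun y => ∑ i ∈ Finset.range n, ((τ : Gal(E/F)) ^ i) y
  have ht : (τ : Gal(E/F)) (t x) = t x := by
    have h1 := Finset.sum_range_succ (fun i => ((τ : Gal(E/F)) ^ i) x) n
    rw [Finset.sum_range_succ', hx, pow_zero, AlgEquiv.one_apply, add_left_inj] at h1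
    simp only [t, map_sum]
    rw [← h1]
    exact Finset.sum_congr rfl fun i _ => by rw [pow_succ', AlgEquiv.mul_apply]
  have htpow : ∀ i, ((τ : Gal(E/F)) ^ i) (t x) = t x := by
    intro i
    induction i with
    | zero => simp
    | succ i ih => rw [pow_succ, AlgEquiv.mul_apply, ht, ih]
  have hy : t (x - (n : E)⁻¹ * t x) = 0 := by
    simp only [t, map_sub, map_mul, map_inv₀, map_natCast, Finset.sum_sub_distrib] at htpow ⊢
    simp only [htpow]
    simp [hn0]
  have hzero : x - (n : E)⁻¹ * t x = 0 := by
    by_contra hne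
    set y := x - (n : E)⁻¹ * t x
    apply hn
    have hsum : (n : E) = -∑ i ∈ Finset.range n, (((τ : Gal(E/F)) ^ i) y / y - 1) := by
      rw [Finset.sum_sub_distrib, ← Finset.sum_div]
      change _ = -(t y / y - _)
      rw [hy]
      simp
    rw [hsum]
    refine A.nonunits.neg_mem (sum_mem fun i _ => ?_)
    exact (pow_mem hτ i : τ ^ i ∈ A.wildInertiaSubgroup F) y hne
  rw [sub_eq_zero] at hzero
  rw [hzero, map_mul, map_inv₀, map_natCast, ht]

end ValuationSubring

/-! ### Integrality and unramifiedness at almost all primes. -/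

section PlacesAbove

open IsDedekindDomain

variable {L : Type*} [Field L] [NumberField L] {A : ValuationSubring (AlgebraicClosure L)}
  {q : HeightOneSpectrum (𝓞 L)}

theorem IsPlaceAbove.algebraMap_mem_iff (hA : IsPlaceAbove A q) (x : L) :
    algebraMap L (AlgebraicClosure L) x ∈ A ↔ q.valuation L x ≤ 1 := by
  rw [← ValuationSubring.mem_comap, hA, Valuation.mem_valuationSubring_iff]

theorem IsPlaceAbove.algebraMap_mem_nonunits_iff (hA : IsPlaceAbove A q) (x : L) :
    algebraMap L (AlgebraicClosure L) x ∈ A.nonunits ↔ q.valuation L x < 1 := by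
  rw [ValuationSubring.mem_nonunits_iff_or, ← map_inv₀, hA.algebraMap_mem_iff, map_eq_zero,
    map_inv₀]
  rcases eq_or_ne x 0 with rfl | hx
  · simp
  · have h0 : q.valuation L x ≠ 0 := (Valuation.ne_zero_iff _).mpr hx
    rw [not_le, one_lt_inv₀ (zero_lt_iff.mpr h0)]
    simp [hx]

theorem ValuationSubring.mem_of_monic_of_coeff_mem {K : Type*} [Field K] (A : ValuationSubring K)
    {f : Polynomial K} (hf : f.Monic) (hc : ∀ i, f.coeff i ∈ A) {x : K} (hx : f.eval x = 0) :
    x ∈ A := by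
  have hsub : (↑f.coeffs : Set K) ⊆ A.toSubring := by
    intro c hcf
    obtain ⟨i, -, rfl⟩ := Polynomial.mem_coeffs_iff.mp hcf
    exact hc i
  have hint : IsIntegral A x := by
    refine ⟨f.toSubring A.toSubring hsub, (Polynomial.monic_toSubring _ _ _).mpr hf, ?_⟩
    have := Polynomial.eval_map (algebraMap A K) x (p := f.toSubring A.toSubring hsub)
    rw [← this]
    have hmap := Polynomial.map_toSubring f A.toSubring hsub
    change Polynomial.eval x ((f.toSubring A.toSubring hsub).map A.toSubring.subtype) = 0
    rw [hmap, hx]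
  obtain ⟨y, rfl⟩ := IsIntegrallyClosed.isIntegral_iff.mp hint
  exact y.2

/-- The coefficients of the minimal polynomial have finitely many poles, and valuation rings are
integrally closed. -/
theorem IsPlaceAbove.eventually_mem (x : AlgebraicClosure L) :
    ∀ᶠ q : HeightOneSpectrum (𝓞 L) in Filter.cofinite,
      ∀ A : ValuationSubring (AlgebraicClosure L), IsPlaceAbove A q → x ∈ A := by
  have hfin : ∀ c : L, ∀ᶠ q : HeightOneSpectrum (𝓞 L) in Filter.cofinite, q.valuation L c ≤ 1 := by
    intro c
    have := HeightOneSpectrum.Support.finite (𝓞 L) c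
    rw [Filter.eventually_cofinite]
    exact this.subset fun q hq => not_le.mp hq
  have hall := (Filter.eventually_all_finset (minpoly L x).support).mpr
    fun i _ => hfin ((minpoly L x).coeff i)
  filter_upwards [hall] with q hq A hA
  have hint : IsIntegral L x := Algebra.IsIntegral.isIntegral x
  refine A.mem_of_monic_of_coeff_mem ((minpoly.monic hint).map (algebraMap L _)) (fun i => ?_)
    (x := x) (by rw [Polynomial.eval_map_algebraMap, minpoly.aeval])
  rw [Polynomial.coeff_map, hA.algebraMap_mem_iff]
  by_cases hi : i ∈ (minpoly L x).support
  · exact hq i hi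
  · rw [Polynomial.notMem_support_iff.mp hi, map_zero]
    exact zero_le_one

theorem IsPlaceAbove.eventually_notMem_nonunits {x : AlgebraicClosure L} (hx : x ≠ 0) :
    ∀ᶠ q : HeightOneSpectrum (𝓞 L) in Filter.cofinite,
      ∀ A : ValuationSubring (AlgebraicClosure L), IsPlaceAbove A q → x ∉ A.nonunits := by
  filter_upwards [IsPlaceAbove.eventually_mem x⁻¹] with q hq A hA h
  rcases A.mem_nonunits_iff_or.mp h with h | h
  · exact hx h
  · exact h (hq A hA)

/-- A finite extension of a number field is unramified at almost all primes. -/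
theorem IsPlaceAbove.eventually_inertia_fixes (x : AlgebraicClosure L) :
    ∀ᶠ q : HeightOneSpectrum (𝓞 L) in Filter.cofinite,
      ∀ A : ValuationSubring (AlgebraicClosure L), IsPlaceAbove A q →
        ∀ σ ∈ A.inertiaSubgroup L, (σ : Gal(AlgebraicClosure L/L)) x = x := by
  have hint : IsIntegral L x := Algebra.IsIntegral.isIntegral x
  -- Away from finitely many `q`, distinct conjugates of `x` differ from `x` by non-elements of the
  -- maximal ideal, whereas inertia moves `x` within its residue class.
  have hall := (Filter.eventually_all_finite
    ((minpoly L x).rootSet_finite (AlgebraicClosure L))).mpr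
    fun y _ => show ∀ᶠ q : HeightOneSpectrum (𝓞 L) in Filter.cofinite, y ≠ x →
      ∀ A : ValuationSubring (AlgebraicClosure L), IsPlaceAbove A q → y - x ∉ A.nonunits by
      by_cases hy : y = x
      · simp [hy]
      · simpa [hy] using IsPlaceAbove.eventually_notMem_nonunits (sub_ne_zero.mpr hy)
  filter_upwards [hall, IsPlaceAbove.eventually_mem x] with q hq hx A hA σ hσ
  by_contra hne
  refine hq ((σ : Gal(AlgebraicClosure L/L)) x) ?_ hne A hA
    (ValuationSubring.apply_sub_mem_nonunits_of_mem_inertia hσ (hx A hA))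
  rw [Polynomial.mem_rootSet]
  refine ⟨minpoly.ne_zero hint, ?_⟩
  rw [Polynomial.aeval_algHom_apply, minpoly.aeval, map_zero]

theorem IsPlaceAbove.eventually_inertia_mem_fixingSubgroup
    (M : IntermediateField L (AlgebraicClosure L)) [FiniteDimensional L M] :
    ∀ᶠ q : HeightOneSpectrum (𝓞 L) in Filter.cofinite,
      ∀ A : ValuationSubring (AlgebraicClosure L), IsPlaceAbove A q →
        ∀ σ ∈ A.inertiaSubgroup L, (σ : Gal(AlgebraicClosure L/L)) ∈ M.fixingSubgroup := by
  obtain ⟨s, hs⟩ := IntermediateField.essFiniteType_iff.mp (inferInstance : Algebra.EssFiniteType L M)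
  have hall := (Filter.eventually_all_finset s).mpr
    fun x _ => IsPlaceAbove.eventually_inertia_fixes x
  filter_upwards [hall] with q hq A hA σ hσ
  rw [← hs]
  rw [IntermediateField.mem_fixingSubgroup_iff]
  have := (IntermediateField.forall_mem_adjoin_smul_eq_self_iff L (S := (s : Set (AlgebraicClosure L)))
    (σ : Gal(AlgebraicClosure L/L)))
  exact this.mpr fun x hx => hq x hx A hA σ hσ

end PlacesAbove

/-! ### Frobenius on algebraic integers. -/

section FrobeniusElement

open IsDedekindDomain

variable {L : Type*} [Field L] [NumberField L]

theorem ValuationSubring.mem_of_isIntegral_int {E : Type*} [Field E] (A : ValuationSubring E)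
    {x : E} (hx : IsIntegral ℤ x) : x ∈ A := by
  obtain ⟨z, hz⟩ := IsIntegrallyClosed.isIntegral_iff.mp (hx.tower_top (A := A))
  rw [← hz]
  exact z.2

/-- A valuation ring of `ℚ`-algebraic numbers which is not trivial on `ℚ` is a localization of the
ring of algebraic integers. -/
theorem ValuationSubring.exists_mul_eq_of_isIntegral {E : Type*} [Field E] [CharZero E]
    [Algebra.IsAlgebraic ℚ E] (A : ValuationSubring E) {l : ℕ} (hl0 : l ≠ 0)
    (hl : (l : E) ∈ A.nonunits) {x : E} (hx : x ∈ A) :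
    ∃ b s : E, IsIntegral ℤ b ∧ IsIntegral ℤ s ∧ s ∉ A.nonunits ∧ x * s = b := by
  let M : IntermediateField ℚ E := IntermediateField.adjoin ℚ {x}
  have : FiniteDimensional ℚ M :=
    IntermediateField.adjoin.finiteDimensional (Algebra.IsIntegral.isIntegral x)
  have : NumberField M := ⟨⟩
  have hintE : ∀ y : 𝓞 M, IsIntegral ℤ (algebraMap M E y) := fun y =>
    (NumberField.RingOfIntegers.isIntegral_coe y).algebraMap
  have hmemA : ∀ y : 𝓞 M, algebraMap M E y ∈ A := fun y => A.mem_of_isIntegral_int (hintE y)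
  let f : 𝓞 M →+* A := ((algebraMap M E).comp (algebraMap (𝓞 M) M)).codRestrict A.toSubring hmemA
  let P : Ideal (𝓞 M) := (IsLocalRing.maximalIdeal A).comap f
  have hP : ∀ y : 𝓞 M, y ∈ P ↔ algebraMap M E y ∈ A.nonunits := fun y =>
    (ValuationSubring.coe_mem_nonunits_iff (a := f y)).symm
  have hPbot : P ≠ ⊥ := by
    intro h
    have hlP : (l : 𝓞 M) ∈ P := by
      rw [hP]
      simpa using hl
    rw [h, Ideal.mem_bot] at hlP
    exact hl0 (by exact_mod_cast hlP)
  let v : HeightOneSpectrum (𝓞 M) := ⟨P, inferInstance, hPbot⟩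
  have hxM : x ∈ M := IntermediateField.mem_adjoin_simple_self ℚ x
  obtain ⟨n, ⟨d, hd⟩, h⟩ := v.exists_primeCompl_mul_eq_or_mul_eq (⟨x, hxM⟩ : M)
  have hd' : algebraMap M E d ∉ A.nonunits := fun h' => hd ((hP d).mpr h')
  rcases h with h | h
  · exact ⟨_, _, hintE n, hintE d, hd', congrArg (algebraMap M E) h⟩
  -- Here `x * n = d` with `d` a unit of `A`; since `x ∈ A`, `n` cannot be a nonunit.
  · refine ⟨_, _, hintE d, hintE n, fun hn => hd' ?_, congrArg (algebraMap M E) h⟩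
    have h' : x * algebraMap M E n = algebraMap M E d := congrArg (algebraMap M E) h
    rw [← h', ValuationSubring.mem_nonunits_iff, map_mul]
    exact mul_lt_one_of_nonneg_of_lt_one_right ((A.valuation_le_one_iff x).mpr hx) zero_le hn

theorem NumberField.isInvariant_integralClosure_algebraicClosure :
    Algebra.IsInvariant (𝓞 L) (integralClosure (𝓞 L) (AlgebraicClosure L))
      Gal(AlgebraicClosure L/L) where
  isInvariant b hb := by
    have hmem : (b : AlgebraicClosure L) ∈ Set.range (algebraMap L (AlgebraicClosure L)) := by
      refine (InfiniteGalois.mem_range_algebraMap_iff_fixed _).mpr fun σ => ?_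
      exact congrArg Subtype.val (hb σ)
    obtain ⟨y, hy⟩ := hmem
    have hyint : IsIntegral (𝓞 L) y := by
      have := b.2
      rw [← hy] at this
      exact (isIntegral_algebraMap_iff (algebraMap L (AlgebraicClosure L)).injective).mp this
    obtain ⟨z, rfl⟩ := IsIntegrallyClosed.isIntegral_iff.mp hyint
    exact ⟨z, Subtype.ext hy⟩

/-- Existence of Frobenius elements on the ring of all algebraic integers. -/
theorem exists_frobenius_integralClosure (q : HeightOneSpectrum (𝓞 L))
    (Q : Ideal (integralClosure (𝓞 L) (AlgebraicClosure L))) [Q.IsPrime] [Q.LiesOver q.asIdeal] :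
    ∃ φ : Gal(AlgebraicClosure L/L), ∃ N, 2 ≤ N ∧
      ∀ b : integralClosure (𝓞 L) (AlgebraicClosure L), φ • b - b ^ N ∈ Q := by
  let B := integralClosure (𝓞 L) (AlgebraicClosure L)
  have := NumberField.isInvariant_integralClosure_algebraicClosure (L := L)
  -- With the discrete topology, continuity of the action means open stabilizers, as the profinite
  -- lifting of residue automorphisms requires.
  let _ : TopologicalSpace B := ⊥
  have : DiscreteTopology B := ⟨rfl⟩
  have : ContinuousSMul Gal(AlgebraicClosure L/L) B := by
    rw [continuousSMul_iff_stabilizer_isOpen]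
    intro b
    convert! stabilizer_isOpen_of_isIntegral (K := L) (b : AlgebraicClosure L) using 2
    ext g
    exact Subtype.ext_iff
  have hqmax : q.asIdeal.IsMaximal := q.isMaximal
  have hQmax : Q.IsMaximal := Ideal.isMaximal_of_isIntegral_of_isMaximal_comap (R := 𝓞 L) Q
    (by rwa [← Ideal.under_def, ← Ideal.LiesOver.over (P := Q) (p := q.asIdeal)])
  let _ : Field (𝓞 L ⧸ q.asIdeal) := Ideal.Quotient.field _
  let _ : Field (B ⧸ Q) := Ideal.Quotient.field _
  let _ : Fintype (𝓞 L ⧸ q.asIdeal) := Fintype.ofFinite _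
  have : Algebra.IsIntegral (𝓞 L ⧸ q.asIdeal) (B ⧸ Q) := inferInstance
  have : Algebra.IsAlgebraic (𝓞 L ⧸ q.asIdeal) (B ⧸ Q) := Algebra.IsIntegral.isAlgebraic
  let F : (B ⧸ Q) ≃ₐ[𝓞 L ⧸ q.asIdeal] (B ⧸ Q) :=
    FiniteField.frobeniusAlgEquivOfAlgebraic (𝓞 L ⧸ q.asIdeal) (B ⧸ Q)
  obtain ⟨g, hg⟩ := Ideal.Quotient.stabilizerHom_surjective_of_profinite
    (G := Gal(AlgebraicClosure L/L)) q.asIdeal Q F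
  refine ⟨g, Fintype.card (𝓞 L ⧸ q.asIdeal), Fintype.one_lt_card, fun b => ?_⟩
  have hb := DFunLike.congr_fun hg (Ideal.Quotient.mk Q b)
  rw [Ideal.Quotient.stabilizerHom_apply] at hb
  have hF : F (Ideal.Quotient.mk Q b) =
      Ideal.Quotient.mk Q b ^ Fintype.card (𝓞 L ⧸ q.asIdeal) := rfl
  rw [hF, ← map_pow] at hb
  exact Ideal.Quotient.eq.mp hb

end FrobeniusElement

/-! ### Frobenius in the decomposition group of a place. -/

section FrobeniusInDecomposition

open IsDedekindDomain ValuationSubring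

variable {L : Type*} [Field L] [NumberField L] {A : ValuationSubring (AlgebraicClosure L)}
  {q : HeightOneSpectrum (𝓞 L)}

theorem IsPlaceAbove.exists_natCast_mem_nonunits (hA : IsPlaceAbove A q) :
    ∃ l : ℕ, l ≠ 0 ∧ (l : AlgebraicClosure L) ∈ A.nonunits := by
  refine ⟨Ideal.absNorm q.asIdeal, fun h => q.ne_bot (Ideal.absNorm_eq_zero_iff.mp h), ?_⟩
  have hmem := Ideal.absNorm_mem q.asIdeal
  have h := (hA.algebraMap_mem_nonunits_iff (algebraMap (𝓞 L) L (Ideal.absNorm q.asIdeal))).mpr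
    ((q.valuation_lt_one_iff_mem _).mpr hmem)
  simpa using h

/-- Frobenius elements of decomposition groups. -/
theorem IsPlaceAbove.exists_frobenius (hA : IsPlaceAbove A q) :
    ∃ φ : A.decompositionSubgroup L, ∃ N, 2 ≤ N ∧
      ∀ w ∈ A.unitGroup, decompositionUnitsHom φ w / w ^ N ∈ A.principalUnitGroup := by
  let B := integralClosure (𝓞 L) (AlgebraicClosure L)
  have hBA : ∀ b : B, (b : AlgebraicClosure L) ∈ A := fun b =>
    A.mem_of_isIntegral_int (isIntegral_trans (R := ℤ) (A := 𝓞 L) _ b.2)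
  let f : B →+* A := B.val.toRingHom.codRestrict A.toSubring hBA
  let Q : Ideal B := (IsLocalRing.maximalIdeal A).comap f
  have hQ : ∀ b : B, b ∈ Q ↔ (b : AlgebraicClosure L) ∈ A.nonunits := fun b =>
    (ValuationSubring.coe_mem_nonunits_iff (a := f b)).symm
  have : Q.LiesOver q.asIdeal := ⟨by
    ext x
    rw [Ideal.under_def, Ideal.mem_comap, hQ, ← q.valuation_lt_one_iff_mem (K := L),
      ← hA.algebraMap_mem_nonunits_iff]
    rfl⟩
  obtain ⟨φ, N, hN, hφ⟩ := exists_frobenius_integralClosure q Q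
  have hφ' : ∀ b : AlgebraicClosure L, IsIntegral ℤ b → φ b - b ^ N ∈ A.nonunits :=
    fun b hb => (hQ _).mp (hφ ⟨b, hb.tower_top⟩)
  have hN0 : N ≠ 0 := by lia
  have hpow : ∀ {s : AlgebraicClosure L}, s ^ N ∈ A.nonunits → s ∈ A.nonunits := by
    intro s hs
    rw [ValuationSubring.mem_nonunits_iff, map_pow] at hs
    exact (pow_lt_one_iff hN0).mp hs
  have hφs : ∀ s, IsIntegral ℤ s → s ∉ A.nonunits → φ s ∉ A.nonunits := by
    intro s hs hsA h
    refine hsA (hpow ?_)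
    simpa using A.nonunits.sub_mem h (hφ' s hs)
  have hφs' : ∀ s, IsIntegral ℤ s → s ∉ A.nonunits → φ⁻¹ s ∉ A.nonunits := by
    intro s hs hsA h
    have hs' : IsIntegral ℤ (φ⁻¹ s) := hs.map (φ⁻¹ : Gal(AlgebraicClosure L/L))
    have h1 := hφ' _ hs'
    rw [← AlgEquiv.mul_apply, mul_inv_cancel, AlgEquiv.one_apply] at h1
    refine hsA ?_
    have h2 : (φ⁻¹ s) ^ N ∈ A.nonunits := by
      rw [ValuationSubring.mem_nonunits_iff, map_pow]
      exact (pow_lt_one_iff hN0).mpr h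
    simpa using A.nonunits.add_mem h1 h2
  obtain ⟨l, hl0, hl⟩ := hA.exists_natCast_mem_nonunits
  have : Algebra.IsAlgebraic ℚ (AlgebraicClosure L) := Algebra.IsAlgebraic.trans ℚ L _
  have hunit : ∀ {s : AlgebraicClosure L}, s ∈ A → s ∉ A.nonunits → A.valuation s = 1 :=
    fun hs hs' => le_antisymm ((A.valuation_le_one_iff _).mpr hs) (not_lt.mp hs')
  -- Elements of `A` are fractions `b / s` of algebraic integers with `s` a unit of `A`, so
  -- preserving such `s` is enough to preserve `A`.
  have hstab : ∀ ψ : Gal(AlgebraicClosure L/L),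
      (∀ s, IsIntegral ℤ s → s ∉ A.nonunits → ψ s ∉ A.nonunits) → ∀ x ∈ A, ψ x ∈ A := by
    intro ψ hψ x hx
    obtain ⟨b, s, hb, hs, hsA, rfl⟩ := A.exists_mul_eq_of_isIntegral hl0 hl hx
    have hb' := A.mem_of_isIntegral_int (hb.map ψ)
    have hs' := hunit (A.mem_of_isIntegral_int (hs.map ψ)) (hψ s hs hsA)
    rw [← A.valuation_le_one_iff, map_mul, map_mul, hs', mul_one] at hb'
    exact (A.valuation_le_one_iff _).mp hb'
  have hmem : φ ∈ A.decompositionSubgroup L := by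
    rw [MulAction.mem_stabilizer_iff]
    ext x
    rw [mem_pointwise_smul_iff_inv_smul_mem]
    refine ⟨fun h => ?_, fun h => hstab φ⁻¹ hφs' x h⟩
    have := hstab φ hφs _ h
    rwa [← AlgEquiv.smul_def, smul_inv_smul] at this
  refine ⟨⟨φ, hmem⟩, N, hN, fun w hw => ?_⟩
  refine div_mem_principalUnitGroup_of_sub_mem_nonunits (pow_mem hw N) ?_
  have hwA : (w : AlgebraicClosure L) ∈ A :=
    (A.valuation_le_one_iff _).mp ((A.mem_unitGroup_iff w).mp hw).le
  obtain ⟨b, s, hb, hs, hsA, hbs⟩ := A.exists_mul_eq_of_isIntegral hl0 hl hwA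
  have hs1 := hunit (A.mem_of_isIntegral_int hs) hsA
  have hs2 := hunit (A.mem_of_isIntegral_int (hs.map φ)) (hφs s hs hsA)
  have hb1 : A.valuation b ≤ 1 := (A.valuation_le_one_iff _).mpr (A.mem_of_isIntegral_int hb)
  -- The congruence for `w = b / s` follows from those for `b` and `s` after multiplying by the unit
  -- `φ s * s ^ N`.
  have key : (φ w - (w : AlgebraicClosure L) ^ N) * (φ s * s ^ N) =
      (φ b - b ^ N) * s ^ N - b ^ N * (φ s - s ^ N) := by
    rw [← hbs, map_mul]
    ring
  rw [ValuationSubring.mem_nonunits_iff, Units.val_pow_eq_pow_val, coe_decompositionUnitsHom]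
  have hval : A.valuation (φ w - (w : AlgebraicClosure L) ^ N) =
      A.valuation ((φ w - (w : AlgebraicClosure L) ^ N) * (φ s * s ^ N)) := by
    rw [map_mul, map_mul, map_pow, hs1, hs2, one_pow, mul_one, mul_one]
  rw [hval, key]
  refine (A.valuation.map_sub _ _).trans_lt (max_lt ?_ ?_)
  · rw [map_mul, map_pow, hs1, one_pow, mul_one]
    exact hφ' b hb
  · rw [map_mul, map_pow]
    exact mul_lt_one_of_nonneg_of_lt_one_right (pow_le_one₀ zero_le hb1) zero_le (hφ' s hs)

end FrobeniusInDecomposition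

/-! ### Ultrametric control of `ρ` on inertia. -/

section RamificationOfRepresentations

open IsDedekindDomain ValuationSubring

attribute [local instance] Matrix.normedAddCommGroup

variable {L : Type*} [Field L] {p : ℕ} [Fact p.Prime]
    {K : Type*} [NormedField K] [NormedAlgebra ℚ_[p] K] {m : ℕ}
    (ρ : Gal(AlgebraicClosure L/L) →ₜ* GL (Fin m) K)

theorem exists_fixingSubgroup_norm_sub_one_lt {ε : ℝ} (hε : 0 < ε) :
    ∃ M : IntermediateField L (AlgebraicClosure L), FiniteDimensional L M ∧
      ∀ σ ∈ M.fixingSubgroup, ‖(ρ σ : Matrix (Fin m) (Fin m) K) - 1‖ < ε := by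
  have hcont : Continuous fun σ => ‖(ρ σ : Matrix (Fin m) (Fin m) K) - 1‖ :=
    ((Units.continuous_val.comp ρ.continuous_toFun).sub continuous_const).norm
  have hmem : {σ | ‖(ρ σ : Matrix (Fin m) (Fin m) K) - 1‖ < ε} ∈
      nhds (1 : Gal(AlgebraicClosure L/L)) :=
    (isOpen_lt hcont continuous_const).mem_nhds (by simpa using hε)
  exact (krullTopology_mem_nhds_one_iff _ _ _).mp hmem

/-- Wild inertia acts trivially if it acts by matrices close to `1` and `p` is prime to the
residue characteristic. -/
theorem map_eq_one_of_mem_wildInertiaSubgroup [CharZero L]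
    {A : ValuationSubring (AlgebraicClosure L)}
    (hp : (p : AlgebraicClosure L) ∉ A.nonunits) {σ : A.decompositionSubgroup L}
    (hσ : σ ∈ A.wildInertiaSubgroup L)
    (hclose : ‖(ρ σ : Matrix (Fin m) (Fin m) K) - 1‖ < 1) : ρ σ = 1 := by
  have := isUltrametricDist_of_padic p K
  let _ := Matrix.ultrametricNormedRing (Fin m) K
  let _ := Matrix.ultrametricNormedAlgebra (Fin m) K
  have := Matrix.isUltrametricDist (n := Fin m) (k := K)
  have hle : ∀ ε : ℝ, 0 < ε → ‖(ρ σ : Matrix (Fin m) (Fin m) K) - 1‖ < ε := by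
    intro ε hε
    obtain ⟨M, _, hM⟩ := exists_fixingSubgroup_norm_sub_one_lt ρ hε
    obtain ⟨n, hn, hnM⟩ := Subgroup.exists_pow_mem_of_isOpen_of_compactSpace
      M.fixingSubgroup_isOpen (σ : Gal(AlgebraicClosure L/L))
    -- Split off the `p`-part: `p ^ a` is a unit of `A`, so `σ ^ b` already fixes `M`; and since `p
    -- ∤ b`, `ρ σ` is as close to `1` as `ρ (σ ^ b)`.
    obtain ⟨a, b, hb, rfl⟩ := Nat.exists_eq_pow_mul_and_not_dvd hn.ne' p
      (Fact.out : p.Prime).ne_one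
    have hpa : ((p ^ a : ℕ) : AlgebraicClosure L) ∉ A.nonunits := by
      rw [Nat.cast_pow]
      intro h
      rw [ValuationSubring.mem_nonunits_iff] at h hp
      rw [map_pow] at h
      exact hp (lt_of_not_ge fun hge => absurd h (not_lt.mpr (one_le_pow₀ hge)))
    have hbM : (σ : Gal(AlgebraicClosure L/L)) ^ b ∈ M.fixingSubgroup := by
      rw [IntermediateField.mem_fixingSubgroup_iff] at hnM ⊢
      intro x hx
      refine apply_eq_self_of_mem_wildInertiaSubgroup (τ := σ ^ b) (pow_mem hσ b) hpa ?_
      rw [Subgroup.coe_pow, ← pow_mul, mul_comm]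
      exact hnM x hx
    refine (norm_sub_one_le_norm_pow_sub_one (k := K) Matrix.norm_one_le_one hclose
      (norm_natCast_eq_one_of_not_dvd p K hb)).trans_lt ?_
    have := hM _ hbM
    rwa [map_pow, Units.val_pow_eq_pow_val] at this
  have hzero : ‖(ρ σ : Matrix (Fin m) (Fin m) K) - 1‖ = 0 := by
    by_contra hne
    exact lt_irrefl _ (hle _ ((norm_nonneg _).lt_of_ne' hne))
  exact Units.ext (sub_eq_zero.mp (norm_eq_zero.mp hzero))

theorem isUnipotentMatrix_of_conj_eq_pow [FiniteDimensional ℚ_[p] K] {g h : GL (Fin m) K} {N : ℕ}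
    (hN : 2 ≤ N) (hgh : h * g * h⁻¹ = g ^ N)
    (hg : ‖(g : Matrix (Fin m) (Fin m) K) - 1‖ < ‖(p : K)‖) : IsUnipotentMatrix g := by
  have := isUltrametricDist_of_padic p K
  let _ := Matrix.ultrametricNormedRing (Fin m) K
  let _ := Matrix.ultrametricNormedAlgebra (Fin m) K
  have := Matrix.isUltrametricDist (n := Fin m) (k := K)
  have : CompleteSpace K := FiniteDimensional.complete ℚ_[p] K
  have : @CompleteSpace (Matrix (Fin m) (Fin m) K)
      (Matrix.ultrametricNormedRing (Fin m) K).toMetricSpace.toUniformSpace :=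
    (inferInstance : CompleteSpace (Fin m → Fin m → K))
  obtain ⟨M, hM, hnil⟩ := Matrix.exists_isNilpotent_pow_sub_one_of_conj hN hgh
  exact isNilpotent_sub_one_of_pow_of_norm_lt_prime Matrix.norm_one_le_one hM hg hnil

end RamificationOfRepresentations

/-! ### Descent to the tame quotient and conclusion. -/

theorem ValuationSubring.wildInertiaSubgroup_le_inertiaSubgroup {F E : Type*} [Field F] [Field E]
    [Algebra F E] (A : ValuationSubring E) : A.wildInertiaSubgroup F ≤ A.inertiaSubgroup F := by
  intro σ hσ
  refine MonoidHom.mem_ker.mpr (RingEquiv.ext fun r => ?_)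
  obtain ⟨a, rfl⟩ := IsLocalRing.residue_surjective r
  change σ • IsLocalRing.residue A a = IsLocalRing.residue A a
  rw [← IsLocalRing.ResidueField.residue_smul, ← sub_eq_zero, ← map_sub,
    IsLocalRing.residue_eq_zero_iff, ← coe_mem_nonunits_iff]
  change (σ : Gal(E/F)) a - a ∈ A.nonunits
  rcases eq_or_ne (a : E) 0 with h0 | h0
  · rw [h0, map_zero, sub_zero]
    exact A.nonunits.zero_mem
  · have h := hσ a h0
    have key : (σ : Gal(E/F)) a - a = (a : E) * ((σ : Gal(E/F)) a / a - 1) := by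
      field_simp
    rw [key, mem_nonunits_iff, map_mul]
    exact mul_lt_one_of_nonneg_of_lt_one_right (A.valuation_le_one a) zero_le h

theorem corollary2 {L : Type*} [Field L] [NumberField L] {p : ℕ} [Fact p.Prime]
    {K : Type*} [NormedField K] [NormedAlgebra ℚ_[p] K] [FiniteDimensional ℚ_[p] K]
    {m : ℕ} (ρ : Gal(AlgebraicClosure L/L) →ₜ* GL (Fin m) K)
    (hρ : (glRepresentation
      (ρ : Gal(AlgebraicClosure L/L) →* GL (Fin m) K)).IsSemisimpleRepresentation) :
    ∀ᶠ q : IsDedekindDomain.HeightOneSpectrum (𝓞 L) in Filter.cofinite,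
      ∀ A : ValuationSubring (AlgebraicClosure L), IsPlaceAbove A q →
        ∃ θ : A.TameDecompositionGroup L →ₜ* GL (Fin m) K,
          (∀ σ : A.decompositionSubgroup L,
            θ (QuotientGroup.mk' (A.wildInertiaSubgroup L) σ) = ρ σ) ∧
          ∀ τ : A.TameDecompositionGroup L,
            A.IsTameInertiaGenerator L τ → IsUnipotentMatrix (θ τ) := by
  -- Radius `‖p‖` serves unipotence; wild inertia needs only radius `1`.
  obtain ⟨M, _, hM⟩ := exists_fixingSubgroup_norm_sub_one_lt ρ (norm_prime_natCast_pos p K)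
  have hp0 : (p : AlgebraicClosure L) ≠ 0 := Nat.cast_ne_zero.mpr (Fact.out : p.Prime).ne_zero
  filter_upwards [IsPlaceAbove.eventually_inertia_mem_fixingSubgroup M,
    IsPlaceAbove.eventually_notMem_nonunits hp0] with q hq hpq A hA
  have hclose : ∀ σ ∈ A.inertiaSubgroup L, _ := fun σ hσ => hM _ (hq A hA σ hσ)
  let r : A.decompositionSubgroup L →* GL (Fin m) K :=
    (ρ : Gal(AlgebraicClosure L/L) →* GL (Fin m) K).comp (A.decompositionSubgroup L).subtype
  have hwild : A.wildInertiaSubgroup L ≤ r.ker := fun σ hσ =>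
    map_eq_one_of_mem_wildInertiaSubgroup ρ (hpq A hA) hσ
      ((hclose σ (A.wildInertiaSubgroup_le_inertiaSubgroup hσ)).trans
        (norm_prime_natCast_lt_one p K))
  have hr : Continuous r := ρ.continuous_toFun.comp continuous_subtype_val
  let θ : A.TameDecompositionGroup L →ₜ* GL (Fin m) K :=
    { QuotientGroup.lift (A.wildInertiaSubgroup L) r hwild with
      continuous_toFun := hr.quotient_lift _ }
  have hθ : ∀ σ : A.decompositionSubgroup L,
      θ (QuotientGroup.mk' (A.wildInertiaSubgroup L) σ) = ρ σ := fun σ => rfl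
  refine ⟨θ, hθ, fun τ hτ => ?_⟩
  have hτI : τ ∈ A.tameInertiaSubgroup L := by
    rw [← hτ]
    exact Subgroup.le_topologicalClosure _ (Subgroup.mem_zpowers τ)
  obtain ⟨σ, hσ, rfl⟩ := hτI
  obtain ⟨φ, N, hN, hφ⟩ := hA.exists_frobenius
  rw [hθ]
  -- The tame relation holds only modulo wild inertia, which `r` kills.
  have hrel : r (φ * σ * φ⁻¹ * (σ ^ N)⁻¹) = 1 :=
    hwild (ValuationSubring.conj_mul_pow_inv_mem_wildInertiaSubgroup hφ hσ)
  rw [map_mul, map_inv, mul_inv_eq_one, map_mul, map_mul, map_inv, map_pow] at hrel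
  exact isUnipotentMatrix_of_conj_eq_pow hN hrel (hclose σ hσ)
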